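/- Let $q$ be a prime power and let $G$ be the $q\times q$ Reed--Solomon kernel over $\mathbb{F}_q$: its columns are indexed by the elements $a\in\mathbb{F}_q$, and its row $i\in\{0,\dots,q-1\}$ is $(a^{q-1-i})_{a\in\mathbb{F}_q}$ (with $0^0=1$). For $n\ge 0$ put $N=q^n$ and consider the polar transform $u\mapsto uG^{\otimes n}$ of $\mathbb{F}_q^N$, whose input coordinates are ordered lexicographically by their $n$ base-$q$ digits. Let $x\in[0,1]$, and let each of the $N$ symbols of $uG^{\otimes n}$ be erased independently with probability $x$ ($q$-ary erasure channel). The erasure rate of the $j$-th effective channel is the probability that $u_j$ is not determined by the preceding inputs $(u_i)_{i<j}$ together with the unerased symbols of $uG^{\otimes n}$. Let $X_n$ be the erasure rate of an effective channel chosen uniformly at random among the $N$ effective channels; write $\mathbb{P}(\,\cdot\mid X_0=x)$ for probabilities over this choice when the underlying erasure probability is $x$. Then, for any $\gamma>0$, any $\beta\in(0,\tfrac12]$ and any $n$ with $N^{-\gamma}\le\tfrac34$, \[ \mathbb{P}\big(X_n\in[N^{-\gamma},1-N^{-\gamma}]\,\big|\,X_0=x\big)\le N^{\gamma\beta-\frac12+\frac{\ln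 6-\frac12\ln\beta+(\beta-\frac12)\ln 4}{\ln q}} \] and \[ \mathbb{P}\big(X_n\ge N^{-\gamma}\,\big|\,X_0=x\big)\le N^{\gamma\beta-\frac12+\frac{\ln 6-\frac12\ln\beta+(\beta-\frac12)\ln 4}{\ln q}}+\frac{x}{1-N^{-\gamma}}. \] -/

import Mathlib

open scoped Matrix

namespace RSPolar

variable (F : Type*) [Field F] [Fintype F]

/-- The `q × q` Reed–Solomon kernel over the field `F` with `q` elements. Columns are indexed by the
elements of `F` (the evaluation points), and row `i ∈ {0, …, q-1}` is the vector of evaluations of the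
monomial `X ^ (q - 1 - i)`; the last row is the all-ones vector. For `q = 2` this is the matrix
`[[1, 0], [1, 1]]`, with the columns in the order `1, 0`. -/
def kernel : Matrix (Fin (Fintype.card F)) F F :=
  Matrix.of fun i a => a ^ (Fintype.card F - 1 - (i : ℕ))

/-- The polar transform of blocklength `N = q ^ n`: the `n`-fold Kronecker power of the kernel.
Row and column indices are written through their `n` digits. -/
def transform (n : ℕ) : Matrix (Fin n → Fin (Fintype.card F)) (Fin n → F) F :=
  Matrix.of fun i a => ∏ k, kernel F (i k) (a k)

variable {F}

/-- The codeword symbols in `E` are erased. The input symbol of index `j` is erased (for successive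
cancellation decoding) if it is not determined by the inputs of smaller index (in the lexicographic order
of the digits) together with the unerased symbols of the codeword `u G`. As the transform is linear, this
does not depend on the transmitted word. -/
def InputErased {n : ℕ} (E : Finset (Fin n → F)) (j : Fin n → Fin (Fintype.card F)) : Prop :=
  ∃ u u' : (Fin n → Fin (Fintype.card F)) → F,
    (∀ i, toLex i < toLex j → u i = u' i) ∧
    (∀ a, a ∉ E → (u ᵥ* transform F n) a = (u' ᵥ* transform F n) a) ∧
    u j ≠ u' j

open Classical in
/-- The erasure rate of the effective channel `j` after `n` polarization steps, i.e. the probability that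
the input symbol `j` is erased, when each of the `q ^ n` codeword symbols is sent over a `q`-ary erasure
channel with erasure probability `x`, independently. -/
noncomputable def erasureRate (n : ℕ) (x : ℝ) (j : Fin n → Fin (Fintype.card F)) : ℝ :=
  ∑ E : Finset (Fin n → F),
    x ^ E.card * (1 - x) ^ Eᶜ.card * (if InputErased E j then 1 else 0)

variable (F)

/-- `ℙ (X_n ∈ A | X_0 = x)`, where `X_n` is the erasure rate of an effective channel chosen uniformly at
random among the `q ^ n` effective channels after `n` polarization steps. -/
noncomputable def prob (n : ℕ) (x : ℝ) (A : Set ℝ) : ℝ :=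
  (Nat.card {j : Fin n → Fin (Fintype.card F) // erasureRate (F := F) n x j ∈ A} : ℝ) /
    (Fintype.card F : ℝ) ^ n

end RSPolar

/-! A combination of kernel rows is a polynomial evaluated on the field, and row `i` carries degree
`q - 1 - i`. Root counting and interpolation therefore show that, with the earlier inputs known,
input `i` of a single kernel is erased exactly when more than `i` of its `q` symbols are. So one
polarization step sends the erasure probability `x` to `T i x = ℙ (Bin(q, x) > i)`, and
`erasureRate_cons` turns the effective channels into iterates of these maps, with the first digit
applied first.

The Lyapunov function is `g y = (y (1 - y)) ^ β`. The core is the one-step drift `∑ i, g (T i x) ≤ q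
R g x` with `R = 3 * 4 ^ β / √(β q)` (`sum_variance_rpow_le_drift`): only about `√(q x (1 - x))` of
the indices lie near the mean `q x`, and elsewhere `T i x` is exponentially close to 0 or 1.
Iteration gives mean at most `R ^ n * g x` for `g X_n`, and Markov's inequality bounds the
probability of the middle interval; `R ^ n` supplies every term of the exponent except `γ β`.

For the second bound, the sum of the tails is `q x`, so `X_n` has mean `x`, and Markov's inequality
handles the values above `1 - N ^ (-γ)`. -/

namespace RSPolar

/-! ### Binomial tails: moments, symmetry, Chernoff bounds, and sums of exponentially decaying
sequences. -/

section Analysis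

open Real Finset

/-- The probability that a binomial random variable with `card α` trials and success probability `x`
exceeds `k`. -/
noncomputable def binomialTail (α : Type*) [Fintype α] (k : ℕ) (x : ℝ) : ℝ :=
  ∑ D : Finset α with k < #D, x ^ #D * (1 - x) ^ (Fintype.card α - #D)

variable {α : Type*} [Fintype α] {x : ℝ}

lemma binomial_weight_nonneg (hx : x ∈ Set.Icc (0 : ℝ) 1) (D : Finset α) :
    0 ≤ x ^ #D * (1 - x) ^ (Fintype.card α - #D) :=
  mul_nonneg (pow_nonneg hx.1 _) (pow_nonneg (by linarith [hx.2]) _)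

lemma sum_binomial_weight :
    ∑ D : Finset α, x ^ #D * (1 - x) ^ (Fintype.card α - #D) = 1 := by
  rw [Fintype.sum_pow_mul_eq_add_pow]; simp

lemma one_sub_binomialTail (k : ℕ) :
    1 - binomialTail α k x =
      ∑ D : Finset α with ¬ k < #D, x ^ #D * (1 - x) ^ (Fintype.card α - #D) := by
  rw [sub_eq_iff_eq_add', binomialTail, Finset.sum_filter_add_sum_filter_not, sum_binomial_weight]

lemma binomialTail_nonneg (hx : x ∈ Set.Icc (0 : ℝ) 1) (k : ℕ) : 0 ≤ binomialTail α k x :=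
  Finset.sum_nonneg fun D _ => binomial_weight_nonneg hx D

lemma binomialTail_le_one (hx : x ∈ Set.Icc (0 : ℝ) 1) (k : ℕ) : binomialTail α k x ≤ 1 := by
  have : 0 ≤ 1 - binomialTail α k x := by
    rw [one_sub_binomialTail]
    exact Finset.sum_nonneg fun D _ => binomial_weight_nonneg hx D
  linarith

lemma binomialTail_mem_Icc (hx : x ∈ Set.Icc (0 : ℝ) 1) (k : ℕ) :
    binomialTail α k x ∈ Set.Icc (0 : ℝ) 1 :=
  ⟨binomialTail_nonneg hx k, binomialTail_le_one hx k⟩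

lemma sum_binomial_weight_mul_pow (z : ℝ) :
    ∑ D : Finset α, x ^ #D * (1 - x) ^ (Fintype.card α - #D) * z ^ #D =
      (x * z + (1 - x)) ^ Fintype.card α := by
  rw [← Fintype.sum_pow_mul_eq_add_pow]
  refine Finset.sum_congr rfl fun D _ => ?_
  rw [mul_pow]; ring

lemma sum_binomial_weight_mul_card :
    ∑ D : Finset α, x ^ #D * (1 - x) ^ (Fintype.card α - #D) * (#D : ℝ) =
      Fintype.card α * x := by
  have h := congrArg (Polynomial.eval x) (bernsteinPolynomial.sum_smul ℝ (Fintype.card α))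
  simp only [bernsteinPolynomial, Polynomial.eval_finsetSum, nsmul_eq_mul, Polynomial.eval_mul,
    Polynomial.eval_natCast, Polynomial.eval_pow, Polynomial.eval_X, Polynomial.eval_sub,
    Polynomial.eval_one] at h
  rw [← h, ← Finset.powerset_univ, Finset.sum_powerset_apply_card
    (fun m => x ^ m * (1 - x) ^ (Fintype.card α - m) * (m : ℝ)), Finset.card_univ]
  refine Finset.sum_congr rfl fun m _ => ?_
  rw [nsmul_eq_mul]; ring

/-- The mean of the binomial distribution as a sum of tails. -/
lemma sum_binomialTail :
    ∑ k ∈ range (Fintype.card α), binomialTail α k x = Fintype.card α * x := by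
  rw [← sum_binomial_weight_mul_card]
  simp only [binomialTail, Finset.sum_filter]
  rw [Finset.sum_comm]
  refine Finset.sum_congr rfl fun D _ => ?_
  rw [← Finset.sum_filter, Finset.sum_const, nsmul_eq_mul, mul_comm]
  congr 2
  have : (range (Fintype.card α)).filter (fun k => k < #D) = range #D := by
    ext k
    simp only [Finset.mem_filter, Finset.mem_range]
    have := Finset.card_le_univ D
    omega
  rw [this, Finset.card_range]

/-- Complementing the random set exchanges successes and failures. This later reduces the drift
estimate to `x ≤ 1 / 2`. -/
lemma binomialTail_one_sub {k : ℕ} (hk : k < Fintype.card α) :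
    binomialTail α k (1 - x) = 1 - binomialTail α (Fintype.card α - 1 - k) x := by
  classical
  rw [one_sub_binomialTail, binomialTail]
  refine Finset.sum_bij' (fun D _ => Dᶜ) (fun D _ => Dᶜ) ?_ ?_ (by simp) (by simp) ?_
  · intro D hD
    simp only [Finset.mem_filter, Finset.mem_univ, true_and, Finset.card_compl] at hD ⊢
    omega
  · intro D hD
    have := Finset.card_le_univ D
    simp only [Finset.mem_filter, Finset.mem_univ, true_and, Finset.card_compl] at hD ⊢
    omega
  · intro D _
    have := Finset.card_le_univ D
    rw [Finset.card_compl, sub_sub_cancel, Nat.sub_sub_self this, mul_comm]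

/-- For one centered Bernoulli variable, `exp w ≤ 1 + w + w ^ 2` leaves no linear term and the
variance as quadratic term; independence raises this to the power `card α`. Keeping the variance,
rather than a Hoeffding constant, matters for small `x`. -/
lemma centered_mgf_le (hx : x ∈ Set.Icc (0 : ℝ) 1) {t : ℝ} (ht : |t| ≤ 1) :
    (x * exp t + (1 - x)) ^ Fintype.card α * exp (-(t * (Fintype.card α * x))) ≤
      exp (Fintype.card α * (x * (1 - x)) * t ^ 2) := by
  obtain ⟨h0, h1⟩ := hx
  have h1' : 0 ≤ 1 - x := by linarith
  have e1 : exp (-(t * (Fintype.card α * x))) = exp (-(t * x)) ^ Fintype.card α := by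
    rw [← Real.exp_nat_mul]; congr 1; ring
  have e2 : exp (Fintype.card α * (x * (1 - x)) * t ^ 2) =
      exp (x * (1 - x) * t ^ 2) ^ Fintype.card α := by
    rw [← Real.exp_nat_mul]; congr 1; ring
  rw [e1, e2, ← mul_pow]
  refine pow_le_pow_left₀ (by positivity) ?_ _
  have key : ∀ w : ℝ, |w| ≤ 1 → exp w ≤ 1 + w + w ^ 2 := fun w hw => by
    have := (abs_le.1 (Real.abs_exp_sub_one_sub_id_le hw)).2
    linarith
  have ha : exp (t * (1 - x)) ≤ 1 + t * (1 - x) + (t * (1 - x)) ^ 2 := by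
    apply key
    rw [abs_mul, abs_of_nonneg h1']
    nlinarith [abs_nonneg t]
  have hb : exp (-(t * x)) ≤ 1 + -(t * x) + (-(t * x)) ^ 2 := by
    apply key
    rw [abs_neg, abs_mul, abs_of_nonneg h0]
    nlinarith [abs_nonneg t]
  have e3 : exp t * exp (-(t * x)) = exp (t * (1 - x)) := by
    rw [← Real.exp_add]; congr 1; ring
  calc (x * exp t + (1 - x)) * exp (-(t * x))
      = x * exp (t * (1 - x)) + (1 - x) * exp (-(t * x)) := by rw [← e3]; ring
    _ ≤ x * (1 + t * (1 - x) + (t * (1 - x)) ^ 2) +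
        (1 - x) * (1 + -(t * x) + (-(t * x)) ^ 2) := by gcongr
    _ = x * (1 - x) * t ^ 2 + 1 := by ring
    _ ≤ exp (x * (1 - x) * t ^ 2) := Real.add_one_le_exp _

lemma binomialTail_le_exp (hx : x ∈ Set.Icc (0 : ℝ) 1) {t : ℝ} (h0 : 0 ≤ t) (h1 : t ≤ 1) (k : ℕ) :
    binomialTail α k x ≤ exp (Fintype.card α * (x * (1 - x)) * t ^ 2) *
      exp (-(t * (k + 1 - Fintype.card α * x))) := by
  have hm := centered_mgf_le (α := α) hx (t := t) (by rwa [abs_of_nonneg h0])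
  rw [← sum_binomial_weight_mul_pow] at hm
  calc binomialTail α k x
      ≤ ∑ D : Finset α, x ^ #D * (1 - x) ^ (Fintype.card α - #D) * exp t ^ #D *
          exp (-(t * (k + 1))) := by
        rw [binomialTail, Finset.sum_filter]
        refine Finset.sum_le_sum fun D _ => ?_
        have hw := binomial_weight_nonneg hx D
        split_ifs with h
        · rw [mul_assoc]
          refine le_mul_of_one_le_right hw ?_
          rw [← Real.exp_nat_mul, ← Real.exp_add]
          refine Real.one_le_exp ?_
          have : (k : ℝ) + 1 ≤ #D := by exact_mod_cast h
          nlinarith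
        · positivity
    _ = _ := (Finset.sum_mul _ _ _).symm
    _ = (∑ D : Finset α, x ^ #D * (1 - x) ^ (Fintype.card α - #D) * exp t ^ #D) *
          exp (-(t * (Fintype.card α * x))) * exp (-(t * (k + 1 - Fintype.card α * x))) := by
        rw [mul_assoc, ← Real.exp_add]; congr 2; ring
    _ ≤ _ := by gcongr

lemma one_sub_binomialTail_le_exp (hx : x ∈ Set.Icc (0 : ℝ) 1) {t : ℝ} (h0 : 0 ≤ t) (h1 : t ≤ 1)
    (k : ℕ) :
    1 - binomialTail α k x ≤ exp (Fintype.card α * (x * (1 - x)) * t ^ 2) *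
      exp (-(t * (Fintype.card α * x - k))) := by
  have hm := centered_mgf_le (α := α) hx (t := -t) (by rwa [abs_neg, abs_of_nonneg h0])
  rw [← sum_binomial_weight_mul_pow, neg_sq] at hm
  calc 1 - binomialTail α k x
      ≤ ∑ D : Finset α, x ^ #D * (1 - x) ^ (Fintype.card α - #D) * exp (-t) ^ #D *
          exp (t * k) := by
        rw [one_sub_binomialTail, Finset.sum_filter]
        refine Finset.sum_le_sum fun D _ => ?_
        have hw := binomial_weight_nonneg hx D
        split_ifs with h
        · positivity
        · rw [mul_assoc]
          refine le_mul_of_one_le_right hw ?_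
          rw [← Real.exp_nat_mul, ← Real.exp_add]
          refine Real.one_le_exp ?_
          have : (#D : ℝ) ≤ k := by exact_mod_cast not_lt.1 h
          nlinarith
    _ = _ := (Finset.sum_mul _ _ _).symm
    _ = (∑ D : Finset α, x ^ #D * (1 - x) ^ (Fintype.card α - #D) * exp (-t) ^ #D) *
          exp (-(-t * (Fintype.card α * x))) * exp (-(t * (Fintype.card α * x - k))) := by
        rw [mul_assoc, ← Real.exp_add]; congr 2; ring
    _ ≤ _ := by gcongr

lemma geom_sum_le_inv {r : ℝ} (h0 : 0 ≤ r) (h1 : r < 1) (n : ℕ) :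
    ∑ k ∈ range n, r ^ k ≤ (1 - r)⁻¹ := by
  rw [← tsum_geometric_of_lt_one h0 h1]
  exact (summable_geometric_of_lt_one h0 h1).sum_le_tsum _ fun k _ => pow_nonneg h0 k

/-- A sequence that decays exponentially on both sides of `m` has small sum. -/
lemma sum_le_of_two_sided_exp_decay {a m : ℝ} (ha : 0 < a) {h : ℕ → ℝ}
    (hnn : ∀ i, 0 ≤ h i) (hr : ∀ i : ℕ, h i ≤ exp (-(a * (i + 1 - m))))
    (hl : ∀ i : ℕ, h i ≤ exp (-(a * (m - i)))) (n : ℕ) :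
    ∑ i ∈ range n, h i ≤ (1 + exp (-a)) / (1 - exp (-a)) := by
  have hr1 : exp (-a) < 1 := by rw [Real.exp_lt_one_iff]; linarith
  have hr0 := (Real.exp_pos (-a)).le
  -- The cut is placed so that the right part is dominated by `1, r, r ^ 2, …` and the left part,
  -- read backwards, by `r, r ^ 2, …`, where `r = exp (-a)`.
  obtain ⟨p, hp1, hp2⟩ : ∃ p : ℕ, m ≤ p + 1 ∧ ∀ i < p, (i : ℝ) + 1 < m := by
    refine ⟨⌈m⌉₊ - 1, ?_, fun i hi => ?_⟩
    · have h1 := Nat.le_ceil m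
      have h2 : ((⌈m⌉₊ : ℕ) : ℝ) ≤ ((⌈m⌉₊ - 1 + 1 : ℕ) : ℝ) := by exact_mod_cast (by omega)
      push_cast at h2
      linarith
    · have : i + 1 < ⌈m⌉₊ := by omega
      have := Nat.lt_ceil.1 this
      exact_mod_cast this
  have h1 : ∑ i ∈ range p, h i ≤ exp (-a) * (1 - exp (-a))⁻¹ := by
    rw [← Finset.sum_range_reflect]
    calc ∑ j ∈ range p, h (p - 1 - j) ≤ ∑ j ∈ range p, exp (-a) * exp (-a) ^ j := by
          refine Finset.sum_le_sum fun j hj => (hl _).trans ?_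
          have hj' := Finset.mem_range.1 hj
          rw [← Real.exp_nat_mul, ← Real.exp_add, Real.exp_le_exp]
          have h3 := hp2 (p - 1) (by omega)
          have h4 : ((p - 1 - j : ℕ) : ℝ) = ((p - 1 : ℕ) : ℝ) - j := by
            rw [Nat.cast_sub (by omega)]
          rw [h4]
          nlinarith
      _ ≤ _ := by
          rw [← Finset.mul_sum]
          exact mul_le_mul_of_nonneg_left (geom_sum_le_inv hr0 hr1 p) hr0
  have h2 : ∑ i ∈ range n, h (p + i) ≤ (1 - exp (-a))⁻¹ := by
    refine (Finset.sum_le_sum fun i _ => (hr (p + i)).trans ?_).trans (geom_sum_le_inv hr0 hr1 n)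
    rw [← Real.exp_nat_mul, Real.exp_le_exp]
    push_cast
    nlinarith
  calc ∑ i ∈ range n, h i ≤ ∑ i ∈ range (p + n), h i :=
        Finset.sum_le_sum_of_subset_of_nonneg (Finset.range_mono (by omega)) fun i _ _ => hnn i
    _ = ∑ i ∈ range p, h i + ∑ i ∈ range n, h (p + i) := Finset.sum_range_add _ _ _
    _ ≤ exp (-a) * (1 - exp (-a))⁻¹ + (1 - exp (-a))⁻¹ := add_le_add h1 h2
    _ = _ := by rw [div_eq_mul_inv]; ring

/-- The left side is `coth (a / 2)`, which behaves like `2 / a` near 0; `13 / 6` leaves room for the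
correction up to `a = 1 / 2`. -/
lemma one_add_exp_neg_div_le {a : ℝ} (h0 : 0 < a) (h1 : a ≤ 1 / 2) :
    (1 + exp (-a)) / (1 - exp (-a)) ≤ 13 / 6 / a := by
  have hq := Real.quadratic_le_exp_of_nonneg h0.le
  have hr1 : exp (-a) < 1 := by rw [Real.exp_lt_one_iff]; linarith
  rw [div_le_div_iff₀ (by linarith) h0]
  have h3 : exp (-a) * exp a = 1 := by rw [← Real.exp_add]; simp
  have h4 : (a + 13 / 6) ≤ (13 / 6 - a) * exp a := by
    refine le_trans ?_ (mul_le_mul_of_nonneg_left hq (by linarith))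
    nlinarith [mul_pos h0 h0, mul_nonneg h0.le (mul_nonneg h0.le (sub_nonneg.2 h1))]
  have h5 := mul_le_mul_of_nonneg_left h4 (Real.exp_pos (-a)).le
  have h6 : exp (-a) * ((13 / 6 - a) * exp a) = 13 / 6 - a := by
    rw [mul_left_comm, h3, mul_one]
  rw [h6] at h5
  linarith

end Analysis

end RSPolar

namespace RSPolar

/-! ### Erasure of inputs: polynomial structure of the kernel and the one-step reduction. -/

section Algebra

open Finset Polynomial

open Classical in
/-- The kernel column `a'` of a set of positions. -/
noncomputable def fiber {α : Type*} [Fintype α] {n : ℕ} (E : Finset (Fin (n + 1) → α))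
    (a' : Fin n → α) : Finset α :=
  univ.filter fun a => (Fin.cons a a' : Fin (n + 1) → α) ∈ E

lemma mem_fiber {α : Type*} [Fintype α] {n : ℕ} {E : Finset (Fin (n + 1) → α)} {a' : Fin n → α}
    {a : α} : a ∈ fiber E a' ↔ (Fin.cons a a' : Fin (n + 1) → α) ∈ E := by
  simp [fiber]

variable {F : Type*} [Field F] [Fintype F]

lemma transform_cons (n : ℕ) (i : Fin (Fintype.card F)) (i' : Fin n → Fin (Fintype.card F))
    (a : F) (a' : Fin n → F) :
    transform F (n + 1) (Fin.cons i i') (Fin.cons a a') = kernel F i a * transform F n i' a' := by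
  simp [transform, Fin.prod_univ_succ]

lemma vecMul_transform_cons (n : ℕ) (u : (Fin (n + 1) → Fin (Fintype.card F)) → F)
    (a : F) (a' : Fin n → F) :
    (u ᵥ* transform F (n + 1)) (Fin.cons a a') =
      ∑ i, ((fun i' => u (Fin.cons i i')) ᵥ* transform F n) a' * kernel F i a := by
  simp only [Matrix.vecMul, dotProduct]
  rw [← (Fin.consEquiv fun _ => Fin (Fintype.card F)).sum_comp, Fintype.sum_prod_type]
  refine Finset.sum_congr rfl fun i _ => ?_
  rw [Finset.sum_mul]
  refine Finset.sum_congr rfl fun i' _ => ?_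
  rw [show (Fin.consEquiv fun _ => Fin (Fintype.card F)) (i, i') = Fin.cons i i' from rfl,
    transform_cons]
  ring

/-- A row combination of the kernel is the vector of values of a polynomial. -/
lemma sum_mul_kernel_eq_eval (p : F[X]) (hp : p.natDegree < Fintype.card F) (a : F) :
    ∑ i : Fin (Fintype.card F), p.coeff (Fintype.card F - 1 - i) * kernel F i a = p.eval a := by
  rw [Polynomial.eval_eq_sum_range' hp, ← Finset.sum_range_reflect,
    ← Fin.sum_univ_eq_sum_range
      (fun i => p.coeff (Fintype.card F - 1 - i) * a ^ (Fintype.card F - 1 - i))]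
  rfl

/-- The polynomial whose values are the combination of the kernel rows with coefficients `c`. -/
noncomputable def rowPolynomial (c : Fin (Fintype.card F) → F) : F[X] :=
  ∑ i : Fin (Fintype.card F), Polynomial.C (c i) * X ^ (Fintype.card F - 1 - (i : ℕ))

lemma eval_rowPolynomial (c : Fin (Fintype.card F) → F) (a : F) :
    (rowPolynomial c).eval a = ∑ i, c i * kernel F i a := by
  simp [rowPolynomial, Polynomial.eval_finsetSum, kernel]

lemma coeff_rowPolynomial (c : Fin (Fintype.card F) → F) (i : Fin (Fintype.card F)) :
    (rowPolynomial c).coeff (Fintype.card F - 1 - (i : ℕ)) = c i := by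
  simp only [rowPolynomial, Polynomial.finsetSum_coeff, Polynomial.coeff_C_mul,
    Polynomial.coeff_X_pow]
  rw [Finset.sum_eq_single i]
  · simp
  · intro k _ hk
    have : (k : ℕ) ≠ i := fun h => hk (Fin.ext h)
    rw [if_neg (by omega), mul_zero]
  · simp

lemma natDegree_rowPolynomial_le {c : Fin (Fintype.card F) → F} {i : Fin (Fintype.card F)}
    (hc : ∀ k < i, c k = 0) : (rowPolynomial c).natDegree ≤ Fintype.card F - 1 - (i : ℕ) := by
  refine Polynomial.natDegree_sum_le_of_forall_le _ _ fun k _ => ?_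
  by_cases hk : k < i
  · simp [hc k hk]
  · refine (Polynomial.natDegree_C_mul_X_pow_le _ _).trans ?_
    have : (i : ℕ) ≤ k := not_lt.1 hk
    omega

/-- If the first `i` coefficients of a row combination vanish, and it vanishes outside a set of at most
`i` columns, then its coefficient of index `i` vanishes. -/
lemma eq_zero_of_vanish {c : Fin (Fintype.card F) → F} {i : Fin (Fintype.card F)}
    (hc : ∀ k < i, c k = 0) {D : Finset F} (hD : #D ≤ (i : ℕ))
    (hv : ∀ a ∉ D, ∑ k, c k * kernel F k a = 0) : c i = 0 := by
  classical
  rw [← coeff_rowPolynomial c i]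
  have h0 : rowPolynomial c = 0 := by
    refine Polynomial.eq_zero_of_natDegree_lt_card_of_eval_eq_zero' _ Dᶜ (fun a ha => ?_) ?_
    · rw [eval_rowPolynomial]
      exact hv a (Finset.mem_compl.1 ha)
    · refine (natDegree_rowPolynomial_le hc).trans_lt ?_
      rw [Finset.card_compl]
      have := i.2
      omega
  rw [h0, Polynomial.coeff_zero]

/-- If more than `i` columns are unconstrained, then a row combination without the first `i` rows can have
any coefficient of index `i`. -/
lemma exists_vanish (i : Fin (Fintype.card F)) {D : Finset F} (hD : (i : ℕ) < #D) (w : F) :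
    ∃ c : Fin (Fintype.card F) → F, (∀ k < i, c k = 0) ∧ c i = w ∧
      ∀ a ∉ D, ∑ k, c k * kernel F k a = 0 := by
  classical
  -- The constrained columns are padded to exactly as many roots as the degree attached to row `i`,
  -- so that the leading coefficient 1 sits at index `i`.
  obtain ⟨S, hDS, hS⟩ : ∃ S : Finset F, Dᶜ ⊆ S ∧ #S = Fintype.card F - 1 - (i : ℕ) := by
    obtain ⟨S, h1, -, h2⟩ := Finset.exists_subsuperset_card_eq (Finset.subset_univ Dᶜ)
      (n := Fintype.card F - 1 - (i : ℕ)) (by rw [Finset.card_compl]; omega)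
      (by rw [Finset.card_univ]; omega)
    exact ⟨S, h1, h2⟩
  set p : F[X] := ∏ b ∈ S, (X - Polynomial.C b) with hp
  have hdeg : p.natDegree = Fintype.card F - 1 - (i : ℕ) := by
    rw [hp, Polynomial.natDegree_finsetProd_X_sub_C_eq_card, hS]
  have hmonic : p.Monic := Polynomial.monic_prod_X_sub_C _ _
  have hlt : p.natDegree < Fintype.card F := by have := i.2; omega
  refine ⟨fun k => w * p.coeff (Fintype.card F - 1 - k), fun k hk => ?_, ?_, fun a ha => ?_⟩
  · have hk' : (k : ℕ) < i := hk
    have := i.2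
    simp only [Polynomial.coeff_eq_zero_of_natDegree_lt
      (show p.natDegree < Fintype.card F - 1 - (k : ℕ) by omega), mul_zero]
  · have : p.coeff (Fintype.card F - 1 - i) = 1 := by
      rw [← hdeg]; exact hmonic
    simp only [this, mul_one]
  · simp only [mul_assoc]
    rw [← Finset.mul_sum, sum_mul_kernel_eq_eval p hlt, hp, Polynomial.eval_prod,
      Finset.prod_eq_zero (hDS (Finset.mem_compl.2 ha)) (by simp), mul_zero]

lemma exists_sum_mul_kernel_eq (w : F → F) :
    ∃ c : Fin (Fintype.card F) → F, ∀ a, ∑ k, c k * kernel F k a = w a := by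
  classical
  refine ⟨fun k => (Lagrange.interpolate univ id w).coeff (Fintype.card F - 1 - k), fun a => ?_⟩
  rw [sum_mul_kernel_eq_eval]
  · simpa using Lagrange.eval_interpolate_at_node w (Set.injOn_id _) (Finset.mem_univ a)
  · have h := Lagrange.degree_interpolate_lt w (s := (univ : Finset F)) (Set.injOn_id _)
    rw [Finset.card_univ] at h
    by_cases h0 : Lagrange.interpolate univ id w = 0
    · rw [h0, Polynomial.natDegree_zero]; exact Fintype.card_pos
    · exact (Polynomial.natDegree_lt_iff_degree_lt h0).2 h

/-- The polar transform is surjective. -/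
lemma exists_vecMul_transform_eq (n : ℕ) (w : (Fin n → F) → F) :
    ∃ u : (Fin n → Fin (Fintype.card F)) → F, u ᵥ* transform F n = w := by
  induction n with
  | zero =>
    refine ⟨fun _ => w default, funext fun a => ?_⟩
    simp [Matrix.vecMul, dotProduct, transform, Subsingleton.elim a default]
  | succ n ih =>
    choose c hc using fun a' : Fin n → F => exists_sum_mul_kernel_eq fun a => w (Fin.cons a a')
    choose v hv using fun i => ih fun a' => c a' i
    refine ⟨fun i => v (i 0) (Fin.tail i), funext fun b => ?_⟩
    rw [← Fin.cons_self_tail b, vecMul_transform_cons, ← hc]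
    refine Finset.sum_congr rfl fun i _ => ?_
    simp only [Fin.cons_zero, Fin.tail_cons]
    rw [hv]

/-- By linearity only the difference of the two inputs matters. -/
lemma inputErased_iff {n : ℕ} {E : Finset (Fin n → F)} {j : Fin n → Fin (Fintype.card F)} :
    InputErased E j ↔ ∃ u : (Fin n → Fin (Fintype.card F)) → F,
      (∀ i, toLex i < toLex j → u i = 0) ∧
      (∀ a, a ∉ E → (u ᵥ* transform F n) a = 0) ∧ u j ≠ 0 := by
  constructor
  · rintro ⟨u, u', h1, h2, h3⟩
    refine ⟨u - u', fun i hi => by simp [h1 i hi], fun a ha => ?_, sub_ne_zero.2 h3⟩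
    rw [Matrix.sub_vecMul, Pi.sub_apply, h2 a ha, sub_self]
  · rintro ⟨u, h1, h2, h3⟩
    exact ⟨u, 0, fun i hi => by simp [h1 i hi], fun a ha => by simp [h2 a ha], h3⟩

lemma toLex_cons_lt {n m : ℕ} {i k : Fin m} {i' k' : Fin n → Fin m} :
    toLex (Fin.cons i i' : Fin (n + 1) → Fin m) < toLex (Fin.cons k k' : Fin (n + 1) → Fin m) ↔
      i < k ∨ i = k ∧ toLex i' < toLex k' := by
  constructor
  · rintro ⟨p, hp1, hp2⟩
    induction p using Fin.cases with
    | zero => exact Or.inl hp2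
    | succ p =>
      refine Or.inr ⟨hp1 0 (Fin.succ_pos p), p, fun l hl => ?_, hp2⟩
      exact hp1 l.succ (Fin.succ_lt_succ_iff.2 hl)
  · rintro (h | ⟨rfl, p, hp1, hp2⟩)
    · exact ⟨0, fun l hl => absurd hl (Fin.not_lt_zero l), h⟩
    · refine ⟨p.succ, fun l hl => ?_, hp2⟩
      induction l using Fin.cases with
      | zero => rfl
      | succ l => exact hp1 l (Fin.succ_lt_succ_iff.1 hl)

/-- One polarization step: after the first digit `i`, a symbol of the inner code is erased if more
than `i` symbols of its kernel column are. -/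
lemma inputErased_cons {n : ℕ} {E : Finset (Fin (n + 1) → F)} {i : Fin (Fintype.card F)}
    {j : Fin n → Fin (Fintype.card F)} :
    InputErased E (Fin.cons i j) ↔
      InputErased (univ.filter fun a' => (i : ℕ) < #(fiber E a')) j := by
  rw [inputErased_iff, inputErased_iff]
  constructor
  · rintro ⟨u, h1, h2, h3⟩
    refine ⟨fun i' => u (Fin.cons i i'), fun i' hi' => ?_, fun a' ha' => ?_, h3⟩
    · exact h1 _ (toLex_cons_lt.2 (Or.inr ⟨rfl, hi'⟩))
    · simp only [Finset.mem_filter, Finset.mem_univ, true_and, not_lt] at ha'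
      -- Column `a'` is a row combination whose coefficients are the inner codewords of the layers
      -- `k`, evaluated at `a'`. Layers before `i` vanish, so a column with at most `i` erasures
      -- forces layer `i` to vanish there.
      refine eq_zero_of_vanish
        (c := fun k => ((fun i' => u (Fin.cons k i')) ᵥ* transform F n) a') ?_ ha' fun a ha => ?_
      · intro k hk
        have : (fun i' => u (Fin.cons k i')) = 0 :=
          funext fun i' => h1 _ (toLex_cons_lt.2 (Or.inl hk))
        simp [this]
      · rw [← vecMul_transform_cons]
        exact h2 _ fun h => ha (mem_fiber.2 h)
  · rintro ⟨u, h1, h2, h3⟩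
    have hex : ∀ a' : Fin n → F, ∃ c : Fin (Fintype.card F) → F, (∀ k < i, c k = 0) ∧
        c i = (u ᵥ* transform F n) a' ∧ ∀ a ∉ fiber E a', ∑ k, c k * kernel F k a = 0 := by
      intro a'
      by_cases ha' : (i : ℕ) < #(fiber E a')
      · exact exists_vanish i ha' _
      · exact ⟨0, fun _ _ => rfl, (h2 a' (by simpa using ha')).symm, fun _ _ => by simp⟩
    -- Each column is completed separately from the prescribed layer `i`. Layers after `i` are
    -- unrestricted inputs, so surjectivity of the inner transform realizes whatever values the
    -- columns require.
    choose c hc1 hc2 hc3 using hex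
    choose v hv using fun k => exists_vecMul_transform_eq n fun a' => c a' k
    set V : Fin (Fintype.card F) → (Fin n → Fin (Fintype.card F)) → F :=
      fun k => if k < i then 0 else if k = i then u else v k with hV
    have hVc : ∀ k, V k ᵥ* transform F n = fun a' => c a' k := by
      intro k
      funext a'
      by_cases hk : k < i
      · simp [hV, hk, hc1 a' k hk]
      · by_cases hk' : k = i
        · subst hk'
          simp [hV, hc2]
        · simp only [hV, hk, hk', if_false, hv]
    refine ⟨fun b => V (b 0) (Fin.tail b), fun b hb => ?_, fun b hb => ?_, ?_⟩
    · rw [← Fin.cons_self_tail b] at hb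
      rcases toLex_cons_lt.1 hb with h | ⟨h, h'⟩
      · simp [hV, h]
      · simp [hV, h, h1 _ h']
    · rw [← Fin.cons_self_tail b, vecMul_transform_cons]
      simp only [Fin.cons_zero, Fin.tail_cons]
      simp only [hVc]
      refine hc3 _ _ fun h => hb ?_
      rwa [mem_fiber, Fin.cons_self_tail] at h
    · simpa [hV] using h3

end Algebra

end RSPolar

namespace RSPolar

/-! ### The recursion for erasure rates, the martingale property and iteration of the drift. -/

section Recursion

open Finset

/-- Sets of positions, described through their kernel columns. -/
noncomputable def fiberEquiv (α : Type*) [Fintype α] (n : ℕ) :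
    Finset (Fin (n + 1) → α) ≃ ((Fin n → α) → Finset α) := by
  classical
  exact
  { toFun := fiber
    invFun := fun e => univ.filter fun b => b 0 ∈ e (Fin.tail b)
    left_inv := fun E => by
      ext b
      simp [mem_fiber, Fin.cons_self_tail]
    right_inv := fun e => by
      ext a' a
      simp [mem_fiber] }

lemma fiberEquiv_apply {α : Type*} [Fintype α] {n : ℕ} (E : Finset (Fin (n + 1) → α)) :
    fiberEquiv α n E = fiber E := rfl

open Classical in
/-- Independent variables `e a`, each of which triggers the event `P`: summing out everything but the
set of indices where the event occurs. -/
lemma sum_prod_mul_filter {ι κ : Type*} [Fintype ι] [DecidableEq ι] [Fintype κ] (W : κ → ℝ)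
    (P : κ → Prop) [DecidablePred P] (I : Finset ι → ℝ) :
    ∑ e : ι → κ, (∏ a, W (e a)) * I (univ.filter fun a => P (e a)) =
      ∑ S : Finset ι, (∏ a, if a ∈ S then ∑ b with P b, W b else ∑ b with ¬ P b, W b) * I S := by
  have h1 : ∀ S : Finset ι,
      (∏ a, if a ∈ S then ∑ b with P b, W b else ∑ b with ¬ P b, W b) =
        ∑ e : ι → κ, if (univ.filter fun a => P (e a)) = S then ∏ a, W (e a) else 0 := by
    intro S
    have h2 : ∀ a, (if a ∈ S then ∑ b with P b, W b else ∑ b with ¬ P b, W b) =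
        ∑ b, if (P b ↔ a ∈ S) then W b else 0 := by
      intro a
      split_ifs with h <;> simp [h, Finset.sum_filter]
    simp only [h2]
    -- The product of sums expands over all `e`; a summand survives exactly when the event pattern
    -- of `e` is `S`.
    rw [Finset.prod_univ_sum, Fintype.piFinset_univ]
    refine Finset.sum_congr rfl fun e _ => ?_
    split_ifs with h
    · refine Finset.prod_congr rfl fun a _ => ?_
      rw [if_pos]
      rw [← h]; simp
    · by_contra hne
      refine h (Finset.ext fun a => ?_)
      have := Finset.prod_ne_zero_iff.1 hne a (Finset.mem_univ a)
      simpa using (ite_ne_right_iff.1 this).1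
  simp only [h1, Finset.sum_mul]
  rw [Finset.sum_comm]
  refine Finset.sum_congr rfl fun e _ => ?_
  simp [ite_mul]

variable {F : Type*} [Field F] [Fintype F]

lemma prod_ite_mem {ι : Type*} [Fintype ι] (S : Finset ι) [DecidablePred (· ∈ S)] (x y : ℝ) :
    ∏ a, (if a ∈ S then x else y) = x ^ #S * y ^ (Fintype.card ι - #S) := by
  classical
  rw [Finset.prod_ite, Finset.prod_const, Finset.prod_const]
  congr 2
  · congr 1; ext; simp
  · rw [← Finset.card_compl]
    congr 1; ext; simp

-- Distinct kernel columns share no symbol, so inner symbols are erased independently, each with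
-- probability `binomialTail F i x`.
open Classical in
lemma erasureRate_cons (n : ℕ) (x : ℝ) (i : Fin (Fintype.card F))
    (j : Fin n → Fin (Fintype.card F)) :
    erasureRate (F := F) (n + 1) x (Fin.cons i j) =
      erasureRate (F := F) n (binomialTail F i x) j := by
  have hw : ∀ (m : ℕ) (y : ℝ) (E : Finset (Fin m → F)),
      y ^ #E * (1 - y) ^ #Eᶜ = ∏ a, if a ∈ E then y else 1 - y := by
    intro m y E
    rw [prod_ite_mem, Finset.card_compl]
  have hsplit : ∀ E : Finset (Fin (n + 1) → F),
      (∏ b, if b ∈ E then x else 1 - x) =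
        ∏ a', x ^ #(fiber E a') * (1 - x) ^ (Fintype.card F - #(fiber E a')) := by
    intro E
    rw [← (Fin.consEquiv fun _ => F).prod_comp, Fintype.prod_prod_type_right]
    refine Finset.prod_congr rfl fun a' _ => ?_
    rw [← prod_ite_mem]
    refine Finset.prod_congr rfl fun a _ => ?_
    simp only [mem_fiber]
    rfl
  simp only [erasureRate, hw, hsplit, inputErased_cons]
  have h := sum_prod_mul_filter (ι := Fin n → F)
    (fun D : Finset F => x ^ #D * (1 - x) ^ (Fintype.card F - #D)) (fun D => (i : ℕ) < #D)
    (fun S => if InputErased S j then 1 else 0)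
  rw [← (fiberEquiv F n).sum_comp] at h
  simp only [fiberEquiv_apply] at h
  rw [one_sub_binomialTail, binomialTail]
  convert h using 4
  exact if_congr Iff.rfl rfl rfl

lemma erasureRate_zero (x : ℝ) (j : Fin 0 → Fin (Fintype.card F)) :
    erasureRate (F := F) 0 x j = x := by
  classical
  have hv : ∀ (u : (Fin 0 → Fin (Fintype.card F)) → F) a, (u ᵥ* transform F 0) a = u j := by
    intro u a
    rw [Matrix.vecMul, dotProduct,
      Fintype.sum_eq_single j fun i hi => absurd (Subsingleton.elim i j) hi]
    simp [transform]
  have h1 : ¬ InputErased (∅ : Finset (Fin 0 → F)) j := by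
    rw [inputErased_iff]
    rintro ⟨u, -, h, h'⟩
    exact h' (by rw [← hv u Fin.elim0]; exact h _ (Finset.notMem_empty _))
  have h2 : InputErased (univ : Finset (Fin 0 → F)) j := by
    refine inputErased_iff.2 ⟨1, fun i hi => ?_, fun a ha => absurd (Finset.mem_univ a) ha,
      one_ne_zero⟩
    rw [Subsingleton.elim i j] at hi
    exact absurd hi (lt_irrefl _)
  have h3 : (univ : Finset (Finset (Fin 0 → F))) = {∅, univ} := by
    ext E
    simp only [Finset.mem_univ, Finset.mem_insert, Finset.mem_singleton, true_iff]
    rcases Finset.eq_empty_or_nonempty E with h | ⟨a, ha⟩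
    · exact Or.inl h
    · exact Or.inr (Finset.eq_univ_iff_forall.2 fun b => by rwa [Subsingleton.elim b a])
  rw [erasureRate, h3, Finset.sum_pair (Finset.univ_nonempty.ne_empty.symm), if_neg h1,
    if_pos h2, Finset.compl_univ, Finset.card_univ, Fintype.card_unique]
  simp

lemma sum_erasureRate_succ (n : ℕ) (x : ℝ) (g : ℝ → ℝ) :
    ∑ j, g (erasureRate (F := F) (n + 1) x j) =
      ∑ i ∈ range (Fintype.card F), ∑ j, g (erasureRate (F := F) n (binomialTail F i x) j) := by
  rw [← (Fin.consEquiv fun _ => Fin (Fintype.card F)).sum_comp, Fintype.sum_prod_type,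
    ← Fin.sum_univ_eq_sum_range
      (fun i => ∑ j, g (erasureRate (F := F) n (binomialTail F i x) j))]
  refine Finset.sum_congr rfl fun i _ => Finset.sum_congr rfl fun j _ => ?_
  rw [← erasureRate_cons]
  rfl

lemma erasureRate_mem_Icc (n : ℕ) {x : ℝ} (hx : x ∈ Set.Icc (0 : ℝ) 1)
    (j : Fin n → Fin (Fintype.card F)) : erasureRate (F := F) n x j ∈ Set.Icc (0 : ℝ) 1 := by
  induction n generalizing x with
  | zero => rwa [erasureRate_zero]
  | succ n ih =>
    rw [← Fin.cons_self_tail j, erasureRate_cons]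
    exact ih (binomialTail_mem_Icc hx _) _

/-- The erasure rates form a martingale. -/
lemma sum_erasureRate (n : ℕ) (x : ℝ) :
    ∑ j, erasureRate (F := F) n x j = (Fintype.card F : ℝ) ^ n * x := by
  induction n generalizing x with
  | zero => simp [erasureRate_zero]
  | succ n ih =>
    rw [sum_erasureRate_succ n x fun y => y]
    simp only [ih]
    rw [← Finset.mul_sum, sum_binomialTail]
    ring

/-- A multiplicative drift of a Lyapunov function in one step gives exponential decay. -/
lemma sum_lyapunov_erasureRate_le {g : ℝ → ℝ} {R : ℝ} (hR : 0 ≤ R)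
    (hstep : ∀ x ∈ Set.Icc (0 : ℝ) 1,
      ∑ i ∈ range (Fintype.card F), g (binomialTail F i x) ≤ Fintype.card F * R * g x)
    (n : ℕ) {x : ℝ} (hx : x ∈ Set.Icc (0 : ℝ) 1) :
    ∑ j, g (erasureRate (F := F) n x j) ≤ (Fintype.card F * R) ^ n * g x := by
  induction n generalizing x with
  | zero => simp [erasureRate_zero]
  | succ n ih =>
    rw [sum_erasureRate_succ]
    calc _ ≤ ∑ i ∈ range (Fintype.card F), (Fintype.card F * R) ^ n * g (binomialTail F i x) :=
          Finset.sum_le_sum fun i _ => ih (binomialTail_mem_Icc hx _)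
      _ ≤ (Fintype.card F * R) ^ n * (Fintype.card F * R * g x) := by
          rw [← Finset.mul_sum]
          exact mul_le_mul_of_nonneg_left (hstep x hx) (by positivity)
      _ = _ := by ring

end Recursion

end RSPolar

namespace RSPolar

/-! ### One-step contraction of the Lyapunov function. -/

section Drift

open Real Finset

variable {α : Type*} [Fintype α] {x β : ℝ}

lemma binomialTail_variance_nonneg (hx : x ∈ Set.Icc (0 : ℝ) 1) (i : ℕ) :
    0 ≤ binomialTail α i x * (1 - binomialTail α i x) :=
  mul_nonneg (binomialTail_nonneg hx i) (by linarith [binomialTail_le_one (α := α) hx i])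

/-- The tails average to `x`, so Cauchy–Schwarz bounds the average of `y (1 - y)`, and concavity of
the power gives the rest. This settles the drift when the contraction factor is at least 1. -/
lemma sum_variance_rpow_le_card_mul (hx : x ∈ Set.Icc (0 : ℝ) 1) (h0 : 0 < β) (h1 : β ≤ 1)
    [Nonempty α] :
    ∑ i ∈ range (Fintype.card α), (binomialTail α i x * (1 - binomialTail α i x)) ^ β ≤
      Fintype.card α * (x * (1 - x)) ^ β := by
  have hq : (0 : ℝ) < Fintype.card α := by exact_mod_cast Fintype.card_pos
  have hJ := (Real.concaveOn_rpow h0.le h1).le_map_sum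
    (t := range (Fintype.card α)) (w := fun _ => (Fintype.card α : ℝ)⁻¹)
    (p := fun i => binomialTail α i x * (1 - binomialTail α i x))
    (fun _ _ => by positivity) (by simp [hq.ne'])
    (fun i _ => binomialTail_variance_nonneg hx i)
  simp only [smul_eq_mul, ← Finset.mul_sum] at hJ
  have hsum : (Fintype.card α : ℝ)⁻¹ *
      ∑ i ∈ range (Fintype.card α), binomialTail α i x * (1 - binomialTail α i x) ≤
        x * (1 - x) := by
    have hcs := sq_sum_le_card_mul_sum_sq (s := range (Fintype.card α))
      (f := fun i => binomialTail α i x)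
    rw [sum_binomialTail, Finset.card_range] at hcs
    have e : ∑ i ∈ range (Fintype.card α), binomialTail α i x * (1 - binomialTail α i x) =
        Fintype.card α * x - ∑ i ∈ range (Fintype.card α), binomialTail α i x ^ 2 := by
      rw [← sum_binomialTail, ← Finset.sum_sub_distrib]
      exact Finset.sum_congr rfl fun i _ => by ring
    rw [e, inv_mul_le_iff₀ hq]
    have : (Fintype.card α : ℝ) * x ^ 2 ≤
        ∑ i ∈ range (Fintype.card α), binomialTail α i x ^ 2 := by
      refine le_of_mul_le_mul_left ?_ hq
      linarith [hcs]
    linarith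
  have := hJ.trans (Real.rpow_le_rpow
    (mul_nonneg (by positivity) (Finset.sum_nonneg fun i _ => binomialTail_variance_nonneg hx i))
    hsum h0.le)
  rwa [inv_mul_le_iff₀ hq] at this

/-- The product `y (1 - y)` is at most either factor, so the Chernoff bounds on both sides of the
mean give decay at rate `β t`; `t` is left free for optimization. -/
lemma sum_variance_rpow_le_exp (hx : x ∈ Set.Icc (0 : ℝ) 1) (h0 : 0 < β) (h1 : β ≤ 1 / 2)
    {t : ℝ} (ht0 : 0 < t) (ht1 : t ≤ 1) :
    ∑ i ∈ range (Fintype.card α), (binomialTail α i x * (1 - binomialTail α i x)) ^ β ≤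
      exp (β * (Fintype.card α * (x * (1 - x))) * t ^ 2) * (13 / 6 / (β * t)) := by
  set v := (Fintype.card α : ℝ) * (x * (1 - x)) with hv
  have hd : ∀ (i : ℕ) (y : ℝ),
      binomialTail α i x * (1 - binomialTail α i x) ≤ exp (v * t ^ 2) * exp (-(t * y)) →
      (binomialTail α i x * (1 - binomialTail α i x)) ^ β * exp (-(β * v * t ^ 2)) ≤
        exp (-(β * t * y)) := by
    intro i y h
    have := Real.rpow_le_rpow (binomialTail_variance_nonneg hx i) h h0.le
    rw [← Real.exp_add, ← Real.exp_mul] at this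
    refine (mul_le_mul_of_nonneg_right this (Real.exp_pos _).le).trans (le_of_eq ?_)
    rw [← Real.exp_add]
    congr 1; ring
  have hn := fun i => binomialTail_nonneg (α := α) hx i
  have ho := fun i => binomialTail_le_one (α := α) hx i
  have hs := sum_le_of_two_sided_exp_decay (a := β * t) (m := Fintype.card α * x) (by positivity)
    (h := fun i => (binomialTail α i x * (1 - binomialTail α i x)) ^ β * exp (-(β * v * t ^ 2)))
    (fun i => mul_nonneg (Real.rpow_nonneg (binomialTail_variance_nonneg hx i) _)
      (Real.exp_pos _).le)
    (fun i => hd i _ ((by nlinarith [hn i, ho i] : _ ≤ binomialTail α i x).trans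
      (binomialTail_le_exp hx ht0.le ht1 i)))
    (fun i => hd i _ ((by nlinarith [hn i, ho i] : _ ≤ 1 - binomialTail α i x).trans
      (one_sub_binomialTail_le_exp hx ht0.le ht1 i)))
    (Fintype.card α)
  rw [← Finset.sum_mul] at hs
  have hs' := hs.trans (one_add_exp_neg_div_le (a := β * t) (by positivity) (by nlinarith))
  rw [Real.exp_neg, mul_inv_le_iff₀ (Real.exp_pos _)] at hs'
  linarith

/-- Markov's inequality for `2 ^ #D - 1`; subtracting 1 makes the bound proportional to the mean. -/
lemma binomialTail_le_geometric (hx : x ∈ Set.Icc (0 : ℝ) 1) (hm : Fintype.card α * x ≤ 9 / 8)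
    (i : ℕ) : binomialTail α i x ≤ 2 * (Fintype.card α * x) * (1 / 2) ^ i := by
  set μ := (Fintype.card α : ℝ) * x with hμ
  have hμ0 : 0 ≤ μ := mul_nonneg (Nat.cast_nonneg _) hx.1
  have h1 : binomialTail α i x * (2 ^ (i + 1) - 1) ≤ exp μ - 1 := by
    calc binomialTail α i x * (2 ^ (i + 1) - 1)
        ≤ ∑ D : Finset α, x ^ #D * (1 - x) ^ (Fintype.card α - #D) * ((2 : ℝ) ^ #D - 1) := by
          rw [binomialTail, Finset.sum_mul, Finset.sum_filter]
          refine Finset.sum_le_sum fun D _ => ?_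
          have hw := binomial_weight_nonneg hx D
          have h2 : (1 : ℝ) ≤ 2 ^ #D := one_le_pow₀ (by norm_num)
          split_ifs with h
          · refine mul_le_mul_of_nonneg_left ?_ hw
            have : (2 : ℝ) ^ (i + 1) ≤ 2 ^ #D := pow_le_pow_right₀ (by norm_num) h
            linarith
          · exact mul_nonneg hw (by linarith)
      _ = (x * 2 + (1 - x)) ^ Fintype.card α - 1 := by
          simp only [mul_sub, mul_one]
          rw [Finset.sum_sub_distrib, sum_binomial_weight_mul_pow, sum_binomial_weight]
      _ ≤ exp μ - 1 := by
          have : exp μ = exp x ^ Fintype.card α := by rw [hμ, Real.exp_nat_mul]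
          rw [this]
          gcongr
          · linarith [hx.1]
          · linarith [Real.add_one_le_exp x]
  have h2 : exp μ - 1 ≤ 2 * μ := by
    -- The chord of `exp` over `[0, 9 / 8]` has slope at most 2, since `exp (9 / 8) ≤ 13 / 4`.
    have hc := convexOn_exp.2 (Set.mem_univ (0 : ℝ)) (Set.mem_univ (9 / 8 : ℝ))
      (by linarith : 0 ≤ 1 - 8 / 9 * μ) (by linarith : 0 ≤ 8 / 9 * μ) (by ring)
    simp only [smul_eq_mul, mul_zero, zero_add, Real.exp_zero] at hc
    rw [show 8 / 9 * μ * (9 / 8) = μ by ring] at hc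
    have he : exp (9 / 8) ≤ 13 / 4 := by
      have h3 : exp (9 / 8) = exp 1 * exp (1 / 8) := by rw [← Real.exp_add]; norm_num
      have h4 := Real.exp_one_lt_d9
      have h5 : exp (1 / 8) ≤ 1 / (1 - 1 / 8) :=
        Real.exp_bound_div_one_sub_of_interval (by norm_num) (by norm_num)
      rw [h3]
      nlinarith [Real.exp_pos (1 / 8)]
    nlinarith
  have h3 : (1 / 2 : ℝ) ^ i * 2 ^ i = 1 := by rw [← mul_pow]; norm_num
  have h4 : (1 : ℝ) ≤ 2 ^ i := one_le_pow₀ (by norm_num)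
  have h5 : binomialTail α i x * 2 ^ i ≤ 2 * μ := by
    refine le_trans (mul_le_mul_of_nonneg_left ?_ (binomialTail_nonneg hx i)) (h1.trans h2)
    rw [pow_succ]; linarith
  calc binomialTail α i x = binomialTail α i x * 2 ^ i * (1 / 2) ^ i := by
        rw [mul_assoc, mul_comm ((2 : ℝ) ^ i), h3, mul_one]
    _ ≤ _ := mul_le_mul_of_nonneg_right h5 (by positivity)

/-- Reflecting the erasure probability does not change the sum of the powers of the variances. -/
lemma sum_variance_rpow_one_sub :
    ∑ i ∈ range (Fintype.card α), (binomialTail α i (1 - x) * (1 - binomialTail α i (1 - x))) ^ β =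
      ∑ i ∈ range (Fintype.card α), (binomialTail α i x * (1 - binomialTail α i x)) ^ β := by
  rw [← Finset.sum_range_reflect]
  refine Finset.sum_congr rfl fun i hi => ?_
  have hi' := Finset.mem_range.1 hi
  rw [binomialTail_one_sub (by omega), sub_sub_cancel,
    show Fintype.card α - 1 - (Fintype.card α - 1 - i) = i by omega, mul_comm]

/-- Here the binomial mean is at most `9 / 8`, so the tails decay geometrically. The ratio `2 ^ (-β)
≤ 1 - β / 2` sums to `2 / β`, and `(9 / 4) ^ β ≤ 3 / 2` completes the constant 3. -/
lemma sum_variance_rpow_le_of_small (hx0 : 0 ≤ x) (hx1 : x ≤ 1 / 2) (h0 : 0 < β) (h1 : β ≤ 1 / 2)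
    (hq : 18 ≤ (Fintype.card α : ℝ)) (hv : Fintype.card α * (x * (1 - x)) ≤ 1) :
    ∑ i ∈ range (Fintype.card α), (binomialTail α i x * (1 - binomialTail α i x)) ^ β ≤
      3 / β * (Fintype.card α * (x * (1 - x))) ^ β := by
  have hx : x ∈ Set.Icc (0 : ℝ) 1 := ⟨hx0, by linarith⟩
  set v := (Fintype.card α : ℝ) * (x * (1 - x)) with hvdef
  have hv0 : 0 ≤ v := mul_nonneg (by linarith) (mul_nonneg hx0 (by linarith))
  have hx9 : x ≤ 1 / 9 := by nlinarith [mul_nonneg hx0 (by linarith : (0 : ℝ) ≤ 1 - x)]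
  have hμ : Fintype.card α * x ≤ 9 / 8 * v := by
    have : 0 ≤ Fintype.card α * x := by positivity
    rw [hvdef]; nlinarith
  set r : ℝ := (1 / 2) ^ β with hr
  have hr0 : 0 ≤ r := by positivity
  have hr1 : r ≤ 1 - β / 2 := by
    have := rpow_one_add_le_one_add_mul_self (s := -(1 / 2)) (p := β) (by norm_num) h0.le
      (by linarith)
    rw [show (1 : ℝ) + -(1 / 2) = 1 / 2 by norm_num] at this
    linarith
  have hterm : ∀ i, (binomialTail α i x * (1 - binomialTail α i x)) ^ β ≤
      3 / 2 * v ^ β * r ^ i := by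
    intro i
    have hn := binomialTail_nonneg (α := α) hx i
    have hb : binomialTail α i x * (1 - binomialTail α i x) ≤ 9 / 4 * v * (1 / 2) ^ i := by
      calc _ ≤ binomialTail α i x := by nlinarith
        _ ≤ _ := binomialTail_le_geometric hx (by linarith) i
        _ ≤ _ := mul_le_mul_of_nonneg_right (by linarith) (by positivity)
    refine (Real.rpow_le_rpow (binomialTail_variance_nonneg hx i) hb h0.le).trans ?_
    rw [Real.mul_rpow (by positivity) (by positivity), Real.mul_rpow (by norm_num) hv0]
    have e : (((1 : ℝ) / 2) ^ i) ^ β = r ^ i := by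
      rw [hr, ← Real.rpow_natCast, ← Real.rpow_natCast, ← Real.rpow_mul (by norm_num),
        ← Real.rpow_mul (by norm_num), mul_comm]
    rw [e]
    have h94 : (9 / 4 : ℝ) ^ β ≤ 3 / 2 := by
      calc (9 / 4 : ℝ) ^ β ≤ (9 / 4 : ℝ) ^ (1 / 2 : ℝ) :=
            Real.rpow_le_rpow_of_exponent_le (by norm_num) h1
        _ = 3 / 2 := by
            rw [← Real.sqrt_eq_rpow, show (9 / 4 : ℝ) = (3 / 2) ^ 2 by norm_num,
              Real.sqrt_sq (by norm_num)]
    gcongr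
  calc _ ≤ ∑ i ∈ range (Fintype.card α), 3 / 2 * v ^ β * r ^ i :=
        Finset.sum_le_sum fun i _ => hterm i
    _ ≤ 3 / 2 * v ^ β * (2 / β) := by
        rw [← Finset.mul_sum]
        refine mul_le_mul_of_nonneg_left ?_ (by positivity)
        refine (geom_sum_le_inv hr0 (by linarith) _).trans ?_
        rw [inv_le_comm₀ (by linarith) (by positivity), inv_div]
        linarith
    _ = _ := by ring

/-- The contraction factor of the Lyapunov function `(x (1 - x)) ^ β` in one polarization step. -/
noncomputable def driftFactor (q β : ℝ) : ℝ := 3 * 4 ^ β / (√β * √q)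

lemma driftFactor_nonneg (q β : ℝ) : 0 ≤ driftFactor q β := by
  unfold driftFactor; positivity

lemma card_mul_driftFactor {q : ℝ} (hq : 0 < q) : q * driftFactor q β = 3 * 4 ^ β * √q / √β := by
  rw [driftFactor]
  have h := Real.mul_self_sqrt hq.le
  have : 0 < √q := Real.sqrt_pos.2 hq
  rcases eq_or_ne (√β) 0 with h' | h'
  · simp [h']
  · field_simp
    linear_combination -h

/-- Since `4 x (1 - x) ≤ 1` and `β ≤ 1 / 2`, its square root is at most its power `β`; this is the
source of `4 ^ β` in the contraction factor. -/
lemma six_mul_sqrt_le_drift {q : ℝ} (hq : 0 < q) (h0 : 0 < β) (h1 : β ≤ 1 / 2)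
    (hpos : 0 < x * (1 - x)) :
    6 * √(β * (q * (x * (1 - x)))) / β ≤ q * driftFactor q β * (x * (1 - x)) ^ β := by
  have h4 : 4 * (x * (1 - x)) ≤ 1 := by nlinarith [sq_nonneg (2 * x - 1)]
  have h5 : √(4 * (x * (1 - x))) ≤ (4 * (x * (1 - x))) ^ β := by
    rw [Real.sqrt_eq_rpow]
    exact Real.rpow_le_rpow_of_exponent_ge (by linarith) h4 h1
  rw [Real.sqrt_mul (by norm_num), show (4 : ℝ) = 2 ^ 2 by norm_num, Real.sqrt_sq (by norm_num),
    Real.mul_rpow (by norm_num) hpos.le, show (2 : ℝ) ^ 2 = 4 by norm_num] at h5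
  rw [card_mul_driftFactor hq, Real.sqrt_mul h0.le, Real.sqrt_mul hq.le]
  have hb : 0 < √β := Real.sqrt_pos.2 h0
  have hbb := Real.mul_self_sqrt h0.le
  calc 6 * (√β * (√q * √(x * (1 - x)))) / β = 3 * √q / √β * (2 * √(x * (1 - x))) := by
        rw [div_mul_eq_mul_div, div_eq_div_iff h0.ne' hb.ne']
        linear_combination (6 * √q * √(x * (1 - x))) * hbb
    _ ≤ 3 * √q / √β * (4 ^ β * (x * (1 - x)) ^ β) := by gcongr
    _ = _ := by ring

lemma three_div_mul_le_drift {q : ℝ} (hq : 9 ≤ β * q) (h0 : 0 < β) (h1 : β ≤ 1 / 2)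
    (hpos : 0 < x * (1 - x)) :
    3 / β * (q * (x * (1 - x))) ^ β ≤ q * driftFactor q β * (x * (1 - x)) ^ β := by
  have hq0 : 0 < q := by
    by_contra h
    nlinarith
  have hb : 0 < √β := Real.sqrt_pos.2 h0
  have hbb := Real.mul_self_sqrt h0.le
  -- In logarithms: `0 ≤ (1 / 2 - β) log (β q) + β log (4 β)`. It follows from `log (β q) ≥ 2`, as
  -- `9 ≥ exp 2`, and `β log (2 β) ≥ β - 1 / 2`.
  have key : q ^ β ≤ 4 ^ β * √q * √β := by
    have h9 : 2 ≤ log (β * q) := by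
      rw [Real.le_log_iff_exp_le (by linarith)]
      have h2 : exp 2 = exp 1 * exp 1 := by rw [← Real.exp_add]; norm_num
      have h3 := Real.exp_one_lt_d9
      rw [h2]
      nlinarith [Real.exp_pos 1]
    rw [Real.log_mul h0.ne' hq0.ne'] at h9
    have hl2 := Real.log_pos (by norm_num : (1 : ℝ) < 2)
    have hl4 : log 4 = log 2 + log 2 := by
      rw [← Real.log_mul (by norm_num) (by norm_num)]; norm_num
    have h2b := Real.one_sub_inv_le_log_of_pos (x := 2 * β) (by positivity)
    rw [Real.log_mul (by norm_num) h0.ne'] at h2b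
    have h2b' := mul_le_mul_of_nonneg_left h2b h0.le
    have e : β * (1 - (2 * β)⁻¹) = β - 1 / 2 := by field_simp
    rw [e] at h2b'
    rw [← Real.log_le_log_iff (by positivity) (by positivity), Real.log_mul (by positivity)
      (by positivity), Real.log_mul (by positivity) (by positivity), Real.log_rpow hq0,
      Real.log_rpow (by norm_num), Real.log_sqrt hq0.le, Real.log_sqrt h0.le, hl4]
    nlinarith [mul_pos h0 hl2, mul_le_mul_of_nonneg_left h9 (by linarith : (0 : ℝ) ≤ 1 / 2 - β)]
  rw [card_mul_driftFactor hq0, Real.mul_rpow hq0.le hpos.le]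
  calc 3 / β * (q ^ β * (x * (1 - x)) ^ β)
      ≤ 3 / β * (4 ^ β * √q * √β * (x * (1 - x)) ^ β) := by gcongr
    _ = _ := by
      rw [← mul_assoc]
      congr 1
      rw [div_mul_eq_mul_div, div_eq_div_iff h0.ne' hb.ne']
      linear_combination (3 * 4 ^ β * √q) * hbb

/-- One polarization step contracts the Lyapunov function `(x (1 - x)) ^ β` on average. -/
lemma sum_variance_rpow_le_drift [Nonempty α] (hx : x ∈ Set.Icc (0 : ℝ) 1) (h0 : 0 < β)
    (h1 : β ≤ 1 / 2) :
    ∑ i ∈ range (Fintype.card α), (binomialTail α i x * (1 - binomialTail α i x)) ^ β ≤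
      Fintype.card α * driftFactor (Fintype.card α) β * (x * (1 - x)) ^ β := by
  have hq0 : (0 : ℝ) < Fintype.card α := by exact_mod_cast Fintype.card_pos
  have hnn : 0 ≤ x * (1 - x) := mul_nonneg hx.1 (by linarith [hx.2])
  have hJ := sum_variance_rpow_le_card_mul (α := α) hx h0 (by linarith)
  rcases hnn.eq_or_lt with hz | hpos
  · rw [← hz, Real.zero_rpow h0.ne', mul_zero] at hJ ⊢
    exact hJ
  rcases le_or_gt 1 (driftFactor (Fintype.card α) β) with hR | hR
  · refine hJ.trans (mul_le_mul_of_nonneg_right ?_ (Real.rpow_nonneg hnn _))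
    exact le_mul_of_one_le_right hq0.le hR
  have hb : 0 < √β := Real.sqrt_pos.2 h0
  have hbq : 9 ≤ β * (Fintype.card α : ℝ) := by
    rw [driftFactor, div_lt_one (by positivity)] at hR
    have h4 : (1 : ℝ) ≤ 4 ^ β := Real.one_le_rpow (by norm_num) h0.le
    have h3 : 3 ≤ √β * √(Fintype.card α : ℝ) := by linarith
    rw [← Real.sqrt_mul h0.le] at h3
    have := (Real.le_sqrt (by norm_num) (by positivity)).1 h3
    linarith
  set v := (Fintype.card α : ℝ) * (x * (1 - x)) with hv
  have hv0 : 0 < v := by positivity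
  -- Three regimes of the variance `v`: for `β v ≥ 1 / 4` the optimal `t = 1 / (2 √(β v))` is
  -- admissible; otherwise `t = 1` serves for `v ≥ 1`, and the geometric bound for `v ≤ 1`.
  rcases le_or_gt (1 / 4) (β * v) with hs | hs
  · refine le_trans ?_ (six_mul_sqrt_le_drift hq0 h0 h1 hpos)
    rw [← hv]
    have hs0 : 1 / 2 ≤ √(β * v) := by
      rw [Real.le_sqrt (by norm_num) (by positivity)]
      norm_num; linarith
    have hss := Real.sq_sqrt (by positivity : 0 ≤ β * v)
    set w := √(β * v) with hw
    have hw0 : 0 < w := by linarith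
    refine (sum_variance_rpow_le_exp hx h0 h1 (t := 1 / (2 * w)) (by positivity)
      (by rw [div_le_one (by positivity)]; linarith)).trans ?_
    rw [← hv, ← hss, show w ^ 2 * (1 / (2 * w)) ^ 2 = 1 / 4 by field_simp; norm_num]
    have he : exp (1 / 4) ≤ 1 / (1 - 1 / 4) :=
      Real.exp_bound_div_one_sub_of_interval (by norm_num) (by norm_num)
    calc exp (1 / 4) * (13 / 6 / (β * (1 / (2 * w))))
        ≤ 1 / (1 - 1 / 4) * (13 / 6 / (β * (1 / (2 * w)))) := by gcongr
      _ = 52 / 9 * (w / β) := by field_simp; norm_num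
      _ ≤ 6 * (w / β) := by gcongr; norm_num
      _ = _ := by ring
  refine le_trans ?_ (three_div_mul_le_drift hbq h0 h1 hpos)
  rw [← hv]
  rcases le_or_gt 1 v with hv1 | hv1
  · refine (sum_variance_rpow_le_exp hx h0 h1 one_pos le_rfl).trans ?_
    rw [← hv]
    have he : exp (1 / 4) ≤ 1 / (1 - 1 / 4) :=
      Real.exp_bound_div_one_sub_of_interval (by norm_num) (by norm_num)
    have he' : exp (β * v * 1 ^ 2) ≤ 4 / 3 :=
      (Real.exp_le_exp.2 (by linarith)).trans (he.trans (by norm_num))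
    calc exp (β * v * 1 ^ 2) * (13 / 6 / (β * 1)) ≤ 4 / 3 * (13 / 6 / (β * 1)) := by gcongr
      _ = 26 / 9 / β := by field_simp; norm_num
      _ ≤ 3 / β * 1 := by rw [mul_one]; gcongr; norm_num
      _ ≤ 3 / β * v ^ β := by gcongr; exact Real.one_le_rpow hv1 h0.le
  · have hq18 : 18 ≤ (Fintype.card α : ℝ) := by nlinarith
    rcases le_total x (1 / 2) with hx2 | hx2
    · exact sum_variance_rpow_le_of_small hx.1 hx2 h0 h1 hq18 hv1.le
    · have e : (1 - x) * (1 - (1 - x)) = x * (1 - x) := by ring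
      have := sum_variance_rpow_le_of_small (α := α) (x := 1 - x) (by linarith [hx.2])
        (by linarith) h0 h1 hq18 (by rw [e]; exact hv1.le)
      rwa [sum_variance_rpow_one_sub, e] at this

end Drift

end RSPolar

namespace RSPolar

/-! ### Markov's inequality and the exponent. -/

section Markov

open Finset

variable {F : Type*} [Field F] [Fintype F]

lemma prob_mono_add (n : ℕ) (x : ℝ) {A B C : Set ℝ} (h : A ⊆ B ∪ C) :
    prob F n x A ≤ prob F n x B + prob F n x C := by
  classical
  simp only [prob, Nat.card_eq_fintype_card, Fintype.card_subtype]
  rw [← add_div]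
  refine div_le_div_of_nonneg_right ?_ (by positivity)
  norm_cast
  refine le_trans (Finset.card_le_card fun j hj => ?_) (Finset.card_union_le _ _)
  simp only [Finset.mem_filter, Finset.mem_univ, true_and, Finset.mem_union] at hj ⊢
  exact h hj

lemma prob_mul_le_of_forall_le (n : ℕ) (x : ℝ) {A : Set ℝ} {g : ℝ → ℝ} {c : ℝ}
    (hg : ∀ j, 0 ≤ g (erasureRate (F := F) n x j)) (hc : ∀ y ∈ A, c ≤ g y) :
    prob F n x A * c ≤ (∑ j, g (erasureRate (F := F) n x j)) / (Fintype.card F : ℝ) ^ n := by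
  classical
  rw [prob, Nat.card_eq_fintype_card, Fintype.card_subtype, div_mul_eq_mul_div]
  refine div_le_div_of_nonneg_right ?_ (by positivity)
  rw [← nsmul_eq_mul, ← Finset.sum_const]
  refine (Finset.sum_le_sum fun j hj => hc _ (Finset.mem_filter.1 hj).2).trans ?_
  exact Finset.sum_le_sum_of_subset_of_nonneg (Finset.filter_subset _ _) fun j _ _ => hg j

lemma prob_Icc_le (n : ℕ) {x β δ : ℝ} (hx : x ∈ Set.Icc (0 : ℝ) 1) (h0 : 0 < β) (h1 : β ≤ 1 / 2)
    (hδ0 : 0 < δ) (hδ : δ ≤ 3 / 4) :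
    prob F n x (Set.Icc δ (1 - δ)) ≤ driftFactor (Fintype.card F) β ^ n * δ ^ (-β) := by
  have hq : (0 : ℝ) < Fintype.card F := by exact_mod_cast Fintype.card_pos
  -- On the interval `y (1 - y) ≥ δ (1 - δ) ≥ δ / 4`, the only use of `δ ≤ 3 / 4`. The factor `(1 /
  -- 4) ^ β` cancels against the maximum of the Lyapunov function at the starting point.
  have hm := prob_mul_le_of_forall_le (F := F) n x (A := Set.Icc δ (1 - δ))
    (g := fun y => (y * (1 - y)) ^ β) (c := (δ / 4) ^ β)
    (fun j => by
      have := erasureRate_mem_Icc (F := F) n hx j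
      exact Real.rpow_nonneg (mul_nonneg this.1 (by linarith [this.2])) _)
    (fun y hy => Real.rpow_le_rpow (by positivity)
      (by nlinarith [mul_nonneg (sub_nonneg.2 hy.1) (sub_nonneg.2 hy.2)]) h0.le)
  have hl := sum_lyapunov_erasureRate_le (F := F) (g := fun y => (y * (1 - y)) ^ β)
    (driftFactor_nonneg _ β) (fun y hy => sum_variance_rpow_le_drift hy h0 h1) n hx
  have hgx : (x * (1 - x)) ^ β ≤ (1 / 4 : ℝ) ^ β :=
    Real.rpow_le_rpow (mul_nonneg hx.1 (by linarith [hx.2])) (by nlinarith [sq_nonneg (2 * x - 1)])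
      h0.le
  have hR := driftFactor_nonneg (Fintype.card F : ℝ) β
  have h4 : (0 : ℝ) < (1 / 4 : ℝ) ^ β := by positivity
  have hδβ : (0 : ℝ) < δ ^ β := by positivity
  have hfin : prob F n x (Set.Icc δ (1 - δ)) * (δ / 4) ^ β ≤
      driftFactor (Fintype.card F) β ^ n * (1 / 4 : ℝ) ^ β := by
    refine hm.trans ?_
    rw [div_le_iff₀ (by positivity)]
    calc _ ≤ _ := hl
      _ ≤ (Fintype.card F * driftFactor (Fintype.card F) β) ^ n * (1 / 4 : ℝ) ^ β :=
          mul_le_mul_of_nonneg_left hgx (by positivity)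
      _ = _ := by rw [mul_pow]; ring
  rw [div_eq_mul_one_div, Real.mul_rpow hδ0.le (by norm_num), ← mul_assoc] at hfin
  rw [Real.rpow_neg hδ0.le, ← div_eq_mul_inv, le_div_iff₀ hδβ]
  exact le_of_mul_le_mul_right hfin h4

lemma prob_Ici_le (n : ℕ) {x δ : ℝ} (hx : x ∈ Set.Icc (0 : ℝ) 1) (hδ : 0 < δ) :
    prob F n x (Set.Ici δ) ≤ x / δ := by
  have hq : (0 : ℝ) < Fintype.card F := by exact_mod_cast Fintype.card_pos
  have hm := prob_mul_le_of_forall_le (F := F) n x (A := Set.Ici δ) (g := fun y => y) (c := δ)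
    (fun j => (erasureRate_mem_Icc (F := F) n hx j).1) (fun y hy => hy)
  rw [sum_erasureRate, mul_div_cancel_left₀ _ (by positivity)] at hm
  rwa [le_div_iff₀ hδ]

lemma driftFactor_pow_mul_rpow {q : ℝ} (hq : 1 < q) {β : ℝ} (hβ : 0 < β) (γ : ℝ) (n : ℕ) :
    driftFactor q β ^ n * ((q ^ n) ^ (-γ)) ^ (-β) =
      (q ^ n) ^ (γ * β - 1 / 2 +
        (Real.log 6 - 1 / 2 * Real.log β + (β - 1 / 2) * Real.log 4) / Real.log q) := by
  have hq0 : 0 < q := by linarith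
  have hlq : Real.log q ≠ 0 := (Real.log_pos hq).ne'
  have hR : 0 < driftFactor q β := by unfold driftFactor; positivity
  have hlR : Real.log (driftFactor q β) =
      Real.log 3 + β * Real.log 4 - (Real.log β / 2 + Real.log q / 2) := by
    rw [driftFactor, Real.log_div (by positivity) (by positivity),
      Real.log_mul (by norm_num) (by positivity), Real.log_mul (by positivity) (by positivity),
      Real.log_rpow (by norm_num), Real.log_sqrt hβ.le, Real.log_sqrt hq0.le]
  have hl6 : Real.log 6 = Real.log 3 + Real.log 2 := by
    rw [← Real.log_mul (by norm_num) (by norm_num)]; norm_num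
  have hl4 : Real.log 4 = Real.log 2 + Real.log 2 := by
    rw [← Real.log_mul (by norm_num) (by norm_num)]; norm_num
  have hN : 0 < q ^ n := by positivity
  refine Real.log_injOn_pos (Set.mem_Ioi.2 (by positivity)) (Set.mem_Ioi.2 (by positivity)) ?_
  rw [Real.log_mul (by positivity) (by positivity), Real.log_pow, ← Real.rpow_mul hN.le,
    Real.log_rpow hN, Real.log_rpow hN, Real.log_pow, hlR, hl6, hl4]
  field_simp
  ring

end Markov

end RSPolar

theorem theorem1 (F : Type*) [Field F] [Fintype F] (q : ℕ) (hq : q = Fintype.card F)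
    (n : ℕ) (N : ℝ) (hN : N = (q : ℝ) ^ n) (γ β x : ℝ) (hγ : 0 < γ) (hβ : β ∈ Set.Ioc (0 : ℝ) (1 / 2))
    (hNγ : N ^ (-γ) ≤ 3 / 4) (hx : x ∈ Set.Icc (0 : ℝ) 1) :
    RSPolar.prob F n x (Set.Icc (N ^ (-γ)) (1 - N ^ (-γ))) ≤
        N ^ (γ * β - 1 / 2 +
          (Real.log 6 - 1 / 2 * Real.log β + (β - 1 / 2) * Real.log 4) / Real.log q) ∧
    RSPolar.prob F n x (Set.Ici (N ^ (-γ))) ≤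
        N ^ (γ * β - 1 / 2 +
          (Real.log 6 - 1 / 2 * Real.log β + (β - 1 / 2) * Real.log 4) / Real.log q) +
        x / (1 - N ^ (-γ)) := by
  have hq1 : (1 : ℝ) < q := by rw [hq]; exact_mod_cast Fintype.one_lt_card
  have hN0 : 0 < N := by rw [hN]; positivity
  have hδ : 0 < N ^ (-γ) := Real.rpow_pos_of_pos hN0 _
  have h1 : RSPolar.prob F n x (Set.Icc (N ^ (-γ)) (1 - N ^ (-γ))) ≤
      N ^ (γ * β - 1 / 2 +
        (Real.log 6 - 1 / 2 * Real.log β + (β - 1 / 2) * Real.log 4) / Real.log q) := by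
    refine (RSPolar.prob_Icc_le n hx hβ.1 hβ.2 hδ hNγ).trans (le_of_eq ?_)
    rw [← hq, hN]
    exact RSPolar.driftFactor_pow_mul_rpow hq1 hβ.1 γ n
  refine ⟨h1, ?_⟩
  refine (RSPolar.prob_mono_add n x fun y hy => ?_).trans
    (add_le_add h1 (RSPolar.prob_Ici_le n hx (by linarith : 0 < 1 - N ^ (-γ))))
  -- Values at least `N ^ (-γ)` are either in the middle interval or near 1.
  rcases le_total y (1 - N ^ (-γ)) with h | h
  · exact Or.inl ⟨hy, h⟩
  · exact Or.inr h
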